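/- There exists an automorphism of a $\mathrm{II}_1$ factor which is locally inner but not inner. Precisely: there are a complex Hilbert space $H$, a von Neumann algebra $M\subseteq B(H)$ that is a $\mathrm{II}_1$ factor (its center is $\mathbb{C}1$, it is infinite-dimensional as a vector space, and it has a faithful normal tracial state), and a $*$-automorphism $\theta$ of $M$ such that - ($\theta$ is locally inner) for every $x\in M$ there is a unitary $u_x\in M$, possibly depending on $x$, with $\theta(x)=u_x x u_x^*$; - ($\theta$ is not inner) there is no unitary $u\in M$ such that $\theta(x)=u x u^*$ for all $x\in M$. -/

import Mathlib

/-- A `*`-automorphism `θ` of a unital `*`-algebra is inner if it is of the form `Ad(u)` for a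
unitary `u` of the algebra. -/
def IsInnerAut {A : Type*} [Ring A] [StarRing A] [Algebra ℂ A] (θ : A ≃⋆ₐ[ℂ] A) : Prop :=
  ∃ u ∈ unitary A, ∀ x : A, θ x = u * x * star u

/-- A `*`-automorphism `θ` of a unital `*`-algebra is locally inner if on each single element it
agrees with some inner automorphism; the unitary may depend on the element. -/
def IsLocallyInnerAut {A : Type*} [Ring A] [StarRing A] [Algebra ℂ A] (θ : A ≃⋆ₐ[ℂ] A) : Prop :=
  ∀ x : A, ∃ u ∈ unitary A, θ x = u * x * star u

section VonNeumann

variable {H : Type*} [NormedAddCommGroup H] [InnerProductSpace ℂ H] [CompleteSpace H]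

/-- A von Neumann algebra is a factor if its center consists of the scalar operators only. -/
def IsVNFactor (M : VonNeumannAlgebra H) : Prop :=
  ∀ z ∈ M, z ∈ M.commutant → ∃ c : ℂ, z = c • (1 : H →L[ℂ] H)

/-- A linear functional on a von Neumann algebra acting on `H` is normal if it is ultraweakly
(`σ`-weakly) continuous, that is, of the form `x ↦ ∑ₙ ⟨ηₙ, x ξₙ⟩` for square-summable sequences
`ξ`, `η` of vectors of `H`. -/
def IsNormalFunctional (M : VonNeumannAlgebra H) (τ : M.toStarSubalgebra →ₗ[ℂ] ℂ) : Prop :=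
  ∃ ξ η : ℕ → H, Summable (fun n => ‖ξ n‖ ^ 2) ∧ Summable (fun n => ‖η n‖ ^ 2) ∧
    ∀ x : M.toStarSubalgebra,
      HasSum (fun n => inner ℂ (η n) ((x : H →L[ℂ] H) (ξ n))) (τ x)

/-- A faithful normal tracial state on a von Neumann algebra. -/
structure IsFaithfulNormalTracialState (M : VonNeumannAlgebra H)
    (τ : M.toStarSubalgebra →ₗ[ℂ] ℂ) : Prop where
  map_one : τ 1 = 1
  nonneg : ∀ x, 0 ≤ (τ (star x * x)).re ∧ (τ (star x * x)).im = 0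
  faithful : ∀ x, τ (star x * x) = 0 → x = 0
  normal : IsNormalFunctional M τ
  tracial : ∀ x y, τ (x * y) = τ (y * x)

/-- A `II₁` factor: an infinite-dimensional factor that has a faithful normal tracial state. -/
structure IsIIOneFactor (M : VonNeumannAlgebra H) : Prop where
  factor : IsVNFactor M
  infinite_dimensional : ¬ FiniteDimensional ℂ M.toStarSubalgebra
  exists_trace : ∃ τ : M.toStarSubalgebra →ₗ[ℂ] ℂ, IsFaithfulNormalTracialState M τ

end VonNeumann

/-! ### Coordinate permutations of ℓ². -/

section PermOp

variable {ι : Type*}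

/-! Let `K` be a group with infinite nontrivial conjugacy classes (here `Equiv.Perm ℕ`), `G` the
group of countably supported functions `ℝ → K`, and `φ` conjugation by a constant `c ≠ 1` of `K`.
The group `G` inherits infinite nontrivial conjugacy classes, so its von Neumann algebra is a II₁
factor.

An operator `x` in it is determined by `x δ₁ ∈ ℓ²(G)`, whose support is a countable set of elements
of `G`. The supports in `ℝ` of these elements have countable union, and cutting `c` off outside that
union gives `k ∈ G` acting on them as `φ` does (`exists_conj_eq_conjConst`). Thus the induced
automorphism is locally inner.

If a unitary `u` implemented it globally, `u δ₁` would be constant on each class `{φ(g) h g⁻¹}`.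
These are all infinite (`infinite_range_conjConst`), because the constant `c` has uncountable
support; square-summability then forces `u δ₁ = 0`. -/

/-- The square-summable functions on `ι`. -/
abbrev EllTwo (ι : Type*) : Type _ := lp (fun _ : ι => ℂ) 2

theorem EllTwo.norm_sq (f : EllTwo ι) : ‖f‖ ^ 2 = ∑' i, ‖f i‖ ^ 2 := by
  simpa using lp.norm_rpow_eq_tsum (p := 2) (by simp) f

theorem EllTwo.summable_sq (f : EllTwo ι) : Summable fun i => ‖f i‖ ^ 2 := by
  simpa using (lp.memℓp f).summable (by simp)

theorem EllTwo.countable_support (f : EllTwo ι) : {i | f i ≠ 0}.Countable := by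
  simpa [Function.support] using f.summable_sq.countable_support

/-- A square-summable function is zero at any point whose value it takes infinitely often. -/
theorem EllTwo.eq_zero_of_infinite (f : EllTwo ι) {i : ι} {s : Set ι} (hs : s.Infinite)
    (h : ∀ j ∈ s, f j = f i) : f i = 0 := by
  have : Infinite s := hs.to_subtype
  have h1 : Summable fun _ : s => ‖f i‖ ^ 2 :=
    (f.summable_sq.comp_injective (Subtype.val_injective (p := (· ∈ s)))).congr fun j => by
      simp [h j.1 j.2]
  simpa using (summable_const_iff _).1 h1

/-- The isometry of `ℓ²(ι)` that permutes coordinates. -/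
noncomputable def permIsometry (π : Equiv.Perm ι) : EllTwo ι →ₗᵢ[ℂ] EllTwo ι where
  toFun f := ⟨fun i => f (π.symm i), memℓp_gen <|
    ((lp.memℓp f).summable (by simp)).comp_injective π.symm.injective⟩
  map_add' _ _ := rfl
  map_smul' _ _ := rfl
  norm_map' f := by
    rw [← sq_eq_sq₀ (norm_nonneg _) (norm_nonneg _), EllTwo.norm_sq, EllTwo.norm_sq]
    exact π.symm.tsum_eq fun i => ‖f i‖ ^ 2

/-- The operator on `ℓ²(ι)` that permutes coordinates. -/
noncomputable def permOp (π : Equiv.Perm ι) : EllTwo ι →L[ℂ] EllTwo ι :=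
  (permIsometry π).toContinuousLinearMap

@[simp]
theorem permOp_apply (π : Equiv.Perm ι) (f : EllTwo ι) (i : ι) :
    permOp π f i = f (π.symm i) := rfl

theorem star_permOp (π : Equiv.Perm ι) : star (permOp π) = permOp π⁻¹ := by
  rw [ContinuousLinearMap.star_eq_adjoint, eq_comm, ContinuousLinearMap.eq_adjoint_iff]
  intro f g
  rw [lp.inner_eq_tsum, lp.inner_eq_tsum, ← π.tsum_eq fun i => inner ℂ (f i) (permOp π g i)]
  simp only [permOp_apply, Equiv.symm_apply_apply]
  rfl

/-- The standard basis vector of `ℓ²(ι)`. -/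
noncomputable def basisVec (i : ι) : EllTwo ι :=
  open Classical in lp.single 2 i 1

theorem basisVec_apply_self (i : ι) : basisVec i i = 1 := by
  simp [basisVec]

theorem basisVec_apply_ne {i j : ι} (h : j ≠ i) : basisVec i j = 0 := by
  simp [basisVec, h]

theorem norm_basisVec (i : ι) : ‖basisVec i‖ = 1 := by
  simp [basisVec, lp.norm_single]

theorem inner_basisVec (i : ι) (f : EllTwo ι) : inner ℂ (basisVec i) f = f i := by
  simp [basisVec, lp.inner_single_left]

theorem permOp_basisVec (π : Equiv.Perm ι) (i : ι) :
    permOp π (basisVec i) = basisVec (π i) := by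
  ext j
  rw [permOp_apply]
  by_cases h : j = π i
  · simp [h, basisVec_apply_self]
  · rw [basisVec_apply_ne h, basisVec_apply_ne]
    rwa [Ne, Equiv.symm_apply_eq]

theorem clm_ext_basisVec {T S : EllTwo ι →L[ℂ] EllTwo ι}
    (h : ∀ i, T (basisVec i) = S (basisVec i)) : T = S := by
  classical
  ext1 f
  have key : ∀ i, lp.single 2 i (f i) = f i • basisVec i := fun i => by
    rw [basisVec, ← lp.single_smul, smul_eq_mul, mul_one]
  have hf := lp.hasSum_single (p := 2) (by simp) f
  refine (hf.mapL T).unique ?_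
  convert hf.mapL S using 2 with i
  rw [key, map_smul, map_smul, h]

theorem linearIndependent_basisVec : LinearIndependent ℂ (basisVec : ι → EllTwo ι) := by
  rw [linearIndependent_iff']
  intro s c hc i hi
  have := congrArg (inner ℂ (basisVec i)) hc
  simp only [inner_sum, inner_smul_right, inner_basisVec, inner_zero_right] at this
  rw [Finset.sum_eq_single i] at this
  · simpa [basisVec_apply_self] using this
  · intro j _ hj
    rw [basisVec_apply_ne hj.symm, mul_zero]
  · exact fun h => absurd hi h

end PermOp

/-! ### Group von Neumann algebras, their trace and induced automorphisms. -/

section GroupAlgebra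

variable {G : Type*} [Group G]

/-- Left translation on `ℓ²(G)`. -/
noncomputable def leftOp (g : G) : EllTwo G →L[ℂ] EllTwo G := permOp (Equiv.mulLeft g)

/-- Right translation on `ℓ²(G)`. -/
noncomputable def rightOp (g : G) : EllTwo G →L[ℂ] EllTwo G := permOp (Equiv.mulRight g)

theorem leftOp_basisVec (g h : G) : leftOp g (basisVec h) = basisVec (g * h) :=
  permOp_basisVec _ _

theorem rightOp_basisVec (g h : G) : rightOp g (basisVec h) = basisVec (h * g) :=
  permOp_basisVec _ _

theorem leftOp_apply (g h : G) (f : EllTwo G) : leftOp g f h = f (g⁻¹ * h) := rfl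

theorem rightOp_apply (g h : G) (f : EllTwo G) : rightOp g f h = f (h * g⁻¹) := rfl

theorem star_leftOp (g : G) : star (leftOp g) = leftOp g⁻¹ := by
  rw [leftOp, star_permOp]
  exact congrArg permOp (Equiv.ext fun _ => rfl)

theorem star_rightOp (g : G) : star (rightOp g) = rightOp g⁻¹ := by
  rw [rightOp, star_permOp]
  exact congrArg permOp (Equiv.ext fun _ => rfl)

theorem leftOp_mul_leftOp_inv (g : G) : leftOp g * leftOp g⁻¹ = 1 := by
  refine clm_ext_basisVec fun h => ?_
  simp [leftOp_basisVec]

variable (G) in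
/-- The group von Neumann algebra, as the commutant of the right translations. -/
noncomputable def groupVN : VonNeumannAlgebra (EllTwo G) where
  toStarSubalgebra := StarSubalgebra.centralizer ℂ (Set.range (rightOp (G := G)))
  centralizer_centralizer' := by
    have : (StarSubalgebra.centralizer ℂ (Set.range (rightOp (G := G)))).carrier =
        Set.centralizer (Set.range rightOp ∪ star (Set.range rightOp)) := rfl
    rw [this]
    -- A triple centralizer is a single centralizer.
    simp

theorem mem_groupVN_iff {x : EllTwo G →L[ℂ] EllTwo G} :
    x ∈ groupVN G ↔ ∀ g, rightOp g * x = x * rightOp g := by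
  have h : x ∈ groupVN G ↔
      x ∈ StarSubalgebra.centralizer ℂ (Set.range (rightOp (G := G))) := Iff.rfl
  rw [h, StarSubalgebra.mem_centralizer_iff]
  constructor
  · exact fun H g => (H _ ⟨g, rfl⟩).1
  · rintro H _ ⟨g, rfl⟩
    rw [star_rightOp]
    exact ⟨H g, H g⁻¹⟩

theorem leftOp_mem_groupVN (g : G) : leftOp g ∈ groupVN G := by
  rw [mem_groupVN_iff]
  intro h
  refine clm_ext_basisVec fun k => ?_
  simp [leftOp_basisVec, rightOp_basisVec, mul_assoc]

theorem groupVN_apply_basisVec {x : EllTwo G →L[ℂ] EllTwo G} (hx : x ∈ groupVN G) (g : G) :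
    x (basisVec g) = rightOp g (x (basisVec 1)) := by
  have := congrArg (fun T => T (basisVec 1)) (mem_groupVN_iff.1 hx g)
  simpa [rightOp_basisVec] using this.symm

/-- The basis vector at the identity is separating for the group von Neumann algebra. -/
theorem groupVN_ext {x y : EllTwo G →L[ℂ] EllTwo G} (hx : x ∈ groupVN G) (hy : y ∈ groupVN G)
    (h : x (basisVec 1) = y (basisVec 1)) : x = y :=
  clm_ext_basisVec fun g => by
    rw [groupVN_apply_basisVec hx, groupVN_apply_basisVec hy, h]

theorem star_groupVN_apply {x : EllTwo G →L[ℂ] EllTwo G} (hx : x ∈ groupVN G) (g : G) :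
    star x (basisVec 1) g = star (x (basisVec 1) g⁻¹) := by
  rw [← inner_basisVec g, ContinuousLinearMap.star_eq_adjoint,
    ContinuousLinearMap.adjoint_inner_right, ← inner_conj_symm, inner_basisVec,
    groupVN_apply_basisVec hx, rightOp_apply, one_mul]
  rfl

/-- A central `z` commutes with left and right translations, so `z δ₁` is constant on conjugacy
classes; being square-summable, it vanishes on the infinite ones, leaving a multiple of `δ₁`. -/
theorem isVNFactor_groupVN
    (icc : ∀ g : G, g ≠ 1 → (Set.range fun h => h * g * h⁻¹).Infinite) :
    IsVNFactor (groupVN G) := by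
  intro z hz hz'
  rw [VonNeumannAlgebra.mem_commutant_iff] at hz'
  have conj_invariant : ∀ g h, z (basisVec 1) (h * g * h⁻¹) = z (basisVec 1) g := by
    intro g h
    have h1 : leftOp h⁻¹ (rightOp h (z (basisVec 1))) = z (basisVec 1) := by
      rw [← groupVN_apply_basisVec hz]
      have := congrArg (fun T => T (basisVec h)) (hz' _ (leftOp_mem_groupVN h⁻¹))
      simpa [leftOp_basisVec] using this
    conv_rhs => rw [← h1, leftOp_apply, rightOp_apply, inv_inv]
  refine ⟨z (basisVec 1) 1, groupVN_ext hz ?_ ?_⟩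
  · exact (groupVN G).toStarSubalgebra.smul_mem (groupVN G).toStarSubalgebra.one_mem _
  · ext g
    by_cases hg : g = 1
    · simp [hg, basisVec_apply_self]
    · simp only [smul_apply, one_apply_eq_self,
        lp.coeFn_smul, Pi.smul_apply, basisVec_apply_ne hg, smul_zero]
      refine EllTwo.eq_zero_of_infinite _ (icc g hg) ?_
      rintro _ ⟨h, rfl⟩
      exact conj_invariant g h

variable (G) in
/-- The canonical trace of the group von Neumann algebra. -/
noncomputable def groupTrace : (groupVN G).toStarSubalgebra →ₗ[ℂ] ℂ where
  toFun x := inner ℂ (basisVec 1) ((x : EllTwo G →L[ℂ] EllTwo G) (basisVec 1))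
  map_add' x y := by simp
  map_smul' c x := by simp

theorem groupTrace_apply (x : (groupVN G).toStarSubalgebra) :
    groupTrace G x = inner ℂ (basisVec 1) ((x : EllTwo G →L[ℂ] EllTwo G) (basisVec 1)) := rfl

theorem groupTrace_star_mul_self (x : (groupVN G).toStarSubalgebra) :
    groupTrace G (star x * x) =
      ((‖(x : EllTwo G →L[ℂ] EllTwo G) (basisVec 1)‖ ^ 2 : ℝ) : ℂ) := by
  rw [groupTrace_apply]
  simp only [MulMemClass.coe_mul, StarMemClass.coe_star, mul_apply_eq_comp,
    ContinuousLinearMap.star_eq_adjoint, ContinuousLinearMap.adjoint_inner_right]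
  simp

/-- Traciality becomes visible in this form: the substitution `g ↦ g⁻¹` swaps the roles of `x` and
`y`. -/
theorem groupTrace_mul (x y : (groupVN G).toStarSubalgebra) :
    groupTrace G (x * y) = ∑' g, (x : EllTwo G →L[ℂ] EllTwo G) (basisVec 1) g⁻¹ *
      (y : EllTwo G →L[ℂ] EllTwo G) (basisVec 1) g := by
  rw [groupTrace_apply, MulMemClass.coe_mul, mul_apply_eq_comp,
    ← ContinuousLinearMap.adjoint_inner_left, ← ContinuousLinearMap.star_eq_adjoint,
    lp.inner_eq_tsum]
  refine tsum_congr fun g => ?_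
  rw [star_groupVN_apply x.2]
  simp [mul_comm]

theorem isFaithfulNormalTracialState_groupTrace :
    IsFaithfulNormalTracialState (groupVN G) (groupTrace G) where
  map_one := by simp [groupTrace_apply, norm_basisVec]
  nonneg x := by
    rw [groupTrace_star_mul_self, Complex.ofReal_re, Complex.ofReal_im]
    exact ⟨by positivity, rfl⟩
  faithful x hx := by
    rw [groupTrace_star_mul_self] at hx
    have h : (x : EllTwo G →L[ℂ] EllTwo G) (basisVec 1) = 0 := by simpa using hx
    exact Subtype.ext (groupVN_ext x.2 (groupVN G).toStarSubalgebra.zero_mem (by simpa using h))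
  normal := by
    have hs : Summable fun n : ℕ => ‖(if n = 0 then basisVec 1 else 0 : EllTwo G)‖ ^ 2 :=
      summable_of_ne_finset_zero (s := {0}) fun n hn => by
        rw [Finset.mem_singleton] at hn
        simp [hn]
    refine ⟨_, _, hs, hs, fun x => ?_⟩
    convert hasSum_single (0 : ℕ) ?_ using 1
    · simp [groupTrace_apply]
    · intro n hn
      simp [hn]
  tracial x y := by
    rw [groupTrace_mul, groupTrace_mul, ← (Equiv.inv G).tsum_eq]
    refine tsum_congr fun g => ?_
    simp [mul_comm]

theorem not_finiteDimensional_groupVN [Infinite G] :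
    ¬ FiniteDimensional ℂ (groupVN G).toStarSubalgebra := by
  intro hfin
  let ev : (groupVN G).toStarSubalgebra →ₗ[ℂ] EllTwo G :=
    { toFun := fun x => (x : EllTwo G →L[ℂ] EllTwo G) (basisVec 1)
      map_add' := fun _ _ => rfl
      map_smul' := fun _ _ => rfl }
  have hli : LinearIndependent ℂ
      (fun g : G => (⟨leftOp g, leftOp_mem_groupVN g⟩ : (groupVN G).toStarSubalgebra)) := by
    refine LinearIndependent.of_comp ev ?_
    convert linearIndependent_basisVec (ι := G) using 1
    ext1 g
    simp [ev, leftOp_basisVec]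
  have := hli.finite
  exact not_finite G

theorem isIIOneFactor_groupVN [Infinite G]
    (icc : ∀ g : G, g ≠ 1 → (Set.range fun h => h * g * h⁻¹).Infinite) :
    IsIIOneFactor (groupVN G) where
  factor := isVNFactor_groupVN icc
  infinite_dimensional := not_finiteDimensional_groupVN
  exists_trace := ⟨_, isFaithfulNormalTracialState_groupTrace⟩

theorem permOp_conj_mem_groupVN (φ : G ≃* G) {x : EllTwo G →L[ℂ] EllTwo G}
    (hx : x ∈ groupVN G) : permOp φ.toEquiv * x * permOp φ.symm.toEquiv ∈ groupVN G := by
  rw [mem_groupVN_iff] at hx ⊢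
  intro g
  have h1 : rightOp g * permOp φ.toEquiv = permOp φ.toEquiv * rightOp (φ.symm g) := by
    refine clm_ext_basisVec fun h => ?_
    simp [rightOp_basisVec, permOp_basisVec]
  have h2 : rightOp (φ.symm g) * permOp φ.symm.toEquiv = permOp φ.symm.toEquiv * rightOp g := by
    refine clm_ext_basisVec fun h => ?_
    simp [rightOp_basisVec, permOp_basisVec]
  rw [← mul_assoc, ← mul_assoc, h1, mul_assoc (permOp _), hx, mul_assoc, mul_assoc, h2]
  simp only [mul_assoc]

theorem permOp_mul_permOp_symm (φ : G ≃* G) :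
    permOp φ.toEquiv * permOp φ.symm.toEquiv = 1 :=
  clm_ext_basisVec fun h => by simp [permOp_basisVec]

/-- The automorphism of the group von Neumann algebra induced by a group automorphism. -/
noncomputable def groupVNAut (φ : G ≃* G) :
    (groupVN G).toStarSubalgebra ≃⋆ₐ[ℂ] (groupVN G).toStarSubalgebra where
  toFun x := ⟨permOp φ.toEquiv * x * permOp φ.symm.toEquiv, permOp_conj_mem_groupVN φ x.2⟩
  invFun x := ⟨permOp φ.symm.toEquiv * x * permOp φ.toEquiv, permOp_conj_mem_groupVN φ.symm x.2⟩
  left_inv x := Subtype.ext <| by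
    have := permOp_mul_permOp_symm φ.symm
    rw [MulEquiv.symm_symm] at this
    simp only [mul_assoc, this, mul_one]
    rw [← mul_assoc, this, one_mul]
  right_inv x := Subtype.ext <| by
    have := permOp_mul_permOp_symm φ
    simp only [mul_assoc, this, mul_one]
    rw [← mul_assoc, this, one_mul]
  map_mul' x y := Subtype.ext <| by
    have := permOp_mul_permOp_symm φ.symm
    rw [MulEquiv.symm_symm] at this
    simp only [MulMemClass.coe_mul, mul_assoc]
    rw [← mul_assoc (permOp φ.symm.toEquiv) (permOp φ.toEquiv), this, one_mul]
  map_add' x y := Subtype.ext <| by simp [mul_add, add_mul]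
  map_star' x := Subtype.ext <| by
    have h1 : star (permOp φ.toEquiv) = permOp φ.symm.toEquiv := star_permOp _
    have h2 : star (permOp φ.symm.toEquiv) = permOp φ.toEquiv := star_permOp _
    change _ = star (permOp φ.toEquiv * (x : EllTwo G →L[ℂ] EllTwo G) * permOp φ.symm.toEquiv)
    rw [star_mul, star_mul, h1, h2, ← mul_assoc]
    rfl
  map_smul' c x := Subtype.ext <| by simp

theorem coe_groupVNAut (φ : G ≃* G) (x : (groupVN G).toStarSubalgebra) :
    (groupVNAut φ x : EllTwo G →L[ℂ] EllTwo G) =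
      permOp φ.toEquiv * x * permOp φ.symm.toEquiv := rfl

theorem leftOp_mem_unitary (g : G) :
    (⟨leftOp g, leftOp_mem_groupVN g⟩ : (groupVN G).toStarSubalgebra) ∈
      unitary (groupVN G).toStarSubalgebra := by
  rw [Unitary.mem_iff]
  constructor <;> refine Subtype.ext ?_
  · simpa [star_leftOp] using leftOp_mul_leftOp_inv g⁻¹
  · simpa [star_leftOp] using leftOp_mul_leftOp_inv g

/-- If a group automorphism agrees with an inner one on every countable set, then the induced
automorphism of the group von Neumann algebra is locally inner. -/
theorem isLocallyInnerAut_groupVNAut (φ : G ≃* G)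
    (hφ : ∀ s : Set G, s.Countable → ∃ k : G, ∀ g ∈ s, φ g = k * g * k⁻¹) :
    IsLocallyInnerAut (groupVNAut φ) := by
  intro x
  obtain ⟨k, hk⟩ := hφ _ ((x : EllTwo G →L[ℂ] EllTwo G) (basisVec 1)).countable_support
  refine ⟨_, leftOp_mem_unitary k, Subtype.ext (groupVN_ext (Subtype.prop _) (Subtype.prop _) ?_)⟩
  simp only [coe_groupVNAut, MulMemClass.coe_mul, StarMemClass.coe_star, star_leftOp,
    mul_apply_eq_comp, leftOp_basisVec, mul_one, permOp_basisVec]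
  have h1 : φ.symm.toEquiv 1 = 1 := map_one φ.symm
  rw [h1, groupVN_apply_basisVec x.2 k⁻¹]
  ext g
  rw [leftOp_apply, rightOp_apply, inv_inv, permOp_apply]
  change (x : EllTwo G →L[ℂ] EllTwo G) (basisVec 1) (φ.symm g) = _
  -- Where the two indices differ, neither lies in the support of `x δ₁`, since `φ` is conjugation
  -- by `k` there; both coefficients are then zero.
  by_cases h : φ.symm g = k⁻¹ * g * k
  · rw [h]
  · have h2 : (x : EllTwo G →L[ℂ] EllTwo G) (basisVec 1) (φ.symm g) = 0 := by
      by_contra h3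
      refine h ?_
      have := hk _ h3
      rw [MulEquiv.apply_symm_apply] at this
      nth_rw 2 [this]
      group
    have h3 : (x : EllTwo G →L[ℂ] EllTwo G) (basisVec 1) (k⁻¹ * g * k) = 0 := by
      by_contra h3
      refine h ?_
      rw [MulEquiv.symm_apply_eq, hk _ h3]
      group
    rw [h2, h3]

/-- If all twisted conjugacy classes of a group automorphism are infinite, then the induced
automorphism of the group von Neumann algebra is not inner. -/
theorem not_isInnerAut_groupVNAut (φ : G ≃* G)
    (hφ : ∀ h : G, (Set.range fun g => φ g * h * g⁻¹).Infinite) :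
    ¬ IsInnerAut (groupVNAut φ) := by
  rintro ⟨u, hu, h⟩
  have intertwine : ∀ g, leftOp (φ g) * (u : EllTwo G →L[ℂ] EllTwo G) = u * leftOp g := by
    intro g
    have h1 := congrArg (· * u) (h ⟨leftOp g, leftOp_mem_groupVN g⟩)
    simp only [mul_assoc, Unitary.star_mul_self_of_mem hu, mul_one] at h1
    have h2 := congrArg Subtype.val h1
    simp only [MulMemClass.coe_mul, coe_groupVNAut] at h2
    rw [← h2]
    congr 1
    refine clm_ext_basisVec fun k => ?_
    simp [leftOp_basisVec, permOp_basisVec]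
  have hw : (u : EllTwo G →L[ℂ] EllTwo G) (basisVec 1) = 0 := by
    ext k
    refine EllTwo.eq_zero_of_infinite _ (hφ k) ?_
    rintro _ ⟨g, rfl⟩
    -- At this coordinate the two sides are the values of `u δ₁` at `k` and at `φ g * k * g⁻¹`.
    have h1 := congrArg (fun T => T (basisVec 1) (φ g * k)) (intertwine g)
    simp only [mul_apply_eq_comp, leftOp_basisVec, mul_one] at h1
    rw [groupVN_apply_basisVec u.2 g, leftOp_apply, rightOp_apply, inv_mul_cancel_left] at h1
    exact h1.symm
  have hu0 : u = 0 :=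
    Subtype.ext (groupVN_ext u.2 (groupVN G).toStarSubalgebra.zero_mem (by simpa using hw))
  have h1 := congrArg (fun T => (T : EllTwo G →L[ℂ] EllTwo G) (basisVec 1) 1)
    (congrArg Subtype.val (Unitary.star_mul_self_of_mem hu))
  simp [hu0, basisVec_apply_self] at h1

end GroupAlgebra

/-! ### Countably supported functions and conjugation by a constant. -/

section CountableSupport

variable (ι K : Type*) [Group K]

/-- The functions `ι → K` that are trivial off a countable set. -/
def countablySupported : Subgroup (ι → K) where
  carrier := {f | {i | f i ≠ 1}.Countable}
  one_mem' := by simp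
  mul_mem' {f g} hf hg := (Set.Countable.union hf hg).mono fun i hi => by
    by_contra h
    simp only [Set.mem_union, Set.mem_ofPred_eq, not_or, not_not] at h
    exact hi (by simp [h.1, h.2])
  inv_mem' {f} hf := by simpa using hf

variable {ι K}

theorem mulSingle_mem_countablySupported [DecidableEq ι] (i : ι) (a : K) :
    Pi.mulSingle i a ∈ countablySupported ι K :=
  (Set.countable_singleton i).mono fun j hj => by
    by_contra h
    exact hj (Pi.mulSingle_eq_of_ne (M := fun _ => K) h a)

/-- Conjugation by a constant function, as an automorphism of the countably supported functions. -/
def conjConst (c : K) : countablySupported ι K ≃* countablySupported ι K where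
  toFun f := ⟨fun i => c * f.1 i * c⁻¹, f.2.mono fun i => mt fun h => by simp [h]⟩
  invFun f := ⟨fun i => c⁻¹ * f.1 i * c, f.2.mono fun i => mt fun h => by simp [h]⟩
  left_inv f := Subtype.ext <| funext fun i => by simp [mul_assoc]
  right_inv f := Subtype.ext <| funext fun i => by simp [mul_assoc]
  map_mul' f g := Subtype.ext <| funext fun i => by simp [mul_assoc]

theorem conjConst_apply (c : K) (f : countablySupported ι K) (i : ι) :
    (conjConst c f : ι → K) i = c * f.1 i * c⁻¹ := rfl

open Classical in
/-- On a countable set of countably supported functions, conjugation by a constant agrees with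
conjugation by a countably supported function. -/
theorem exists_conj_eq_conjConst (c : K) (s : Set (countablySupported ι K)) (hs : s.Countable) :
    ∃ k : countablySupported ι K, ∀ f ∈ s, conjConst c f = k * f * k⁻¹ := by
  have hT : (⋃ f ∈ s, {i | f.1 i ≠ 1}).Countable := hs.biUnion fun f _ => f.2
  refine ⟨⟨fun i => if i ∈ ⋃ f ∈ s, {i | f.1 i ≠ 1} then c else 1,
    hT.mono fun i hi => by by_contra h; exact hi (if_neg h)⟩, fun f hf => ?_⟩
  ext1
  funext i
  by_cases h : f.1 i = 1
  · simp [conjConst_apply, h]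
  · have hi : i ∈ ⋃ f ∈ s, {i | f.1 i ≠ 1} := Set.mem_biUnion hf h
    simp only [conjConst_apply, Subgroup.coe_mul, Subgroup.coe_inv, Pi.mul_apply, Pi.inv_apply,
      if_pos hi]

/-- If the nontrivial conjugacy classes of `K` are infinite, then so is the orbit of any `τ ≠ 1` in
`ι → K` under conjugation by countably supported functions. -/
theorem infinite_range_conj (icc : ∀ a : K, a ≠ 1 → (Set.range fun b => b * a * b⁻¹).Infinite)
    {τ : ι → K} (hτ : τ ≠ 1) :
    (Set.range fun k : countablySupported ι K => k.1 * τ * k.1⁻¹).Infinite := by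
  classical
  obtain ⟨i, hi⟩ := Function.ne_iff.1 hτ
  refine Set.Infinite.of_image (fun f => f i) ((icc (τ i) hi).mono ?_)
  rintro _ ⟨b, rfl⟩
  exact ⟨_, ⟨⟨_, mulSingle_mem_countablySupported i b⟩, rfl⟩, by simp⟩

theorem infinite_range_conj_countablySupported
    (icc : ∀ a : K, a ≠ 1 → (Set.range fun b => b * a * b⁻¹).Infinite)
    (f : countablySupported ι K) (hf : f ≠ 1) :
    (Set.range fun k => k * f * k⁻¹).Infinite := by
  refine Set.Infinite.of_image Subtype.val ?_
  rw [← Set.range_comp]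
  exact infinite_range_conj icc fun h => hf (Subtype.ext h)

/-- Multiplying by `c⁻¹` on the left turns the twisted class of `f` into the conjugation orbit of
`c⁻¹ f`, which is nontrivial because `f` can equal `c` only on a countable set. -/
theorem infinite_range_conjConst [Uncountable ι]
    (icc : ∀ a : K, a ≠ 1 → (Set.range fun b => b * a * b⁻¹).Infinite)
    {c : K} (hc : c ≠ 1) (f : countablySupported ι K) :
    (Set.range fun k => conjConst c k * f * k⁻¹).Infinite := by
  have hτ : (fun i => c⁻¹ * f.1 i) ≠ 1 := by
    intro h
    refine Set.not_countable_univ (α := ι) (f.2.mono fun i _ => ?_)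
    have h1 : f.1 i = c := (inv_mul_eq_one.1 (congrFun h i)).symm
    simpa [h1] using hc
  refine Set.Infinite.of_image (fun g i => c⁻¹ * g.1 i) ?_
  rw [← Set.range_comp]
  convert infinite_range_conj icc hτ using 3 with k
  funext i
  simp [conjConst_apply, mul_assoc]

end CountableSupport

/-- The group of permutations of an infinite set has infinite nontrivial conjugacy classes. -/
theorem Equiv.Perm.infinite_range_conj {X : Type*} [Infinite X] (σ : Equiv.Perm X) (hσ : σ ≠ 1) :
    (Set.range fun ρ => ρ * σ * ρ⁻¹).Infinite := by
  classical
  obtain ⟨x, hx⟩ : ∃ x, σ x ≠ x := by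
    by_contra! h
    exact hσ (Equiv.ext h)
  refine Set.Infinite.of_image (fun ρ : Equiv.Perm X => ρ x) ?_
  refine ((Set.toFinite {x}).infinite_compl).mono fun z hz => ?_
  -- This swap fixes `x`, as `σ x` and `z` both differ from it, so the conjugate sends `x` to `z`.
  refine ⟨_, ⟨Equiv.swap (σ x) z, rfl⟩, ?_⟩
  simp [Equiv.swap_apply_of_ne_of_ne hx.symm (Ne.symm hz)]

theorem theorem2p4 :
    ∃ (H : Type) (_ : NormedAddCommGroup H) (_ : InnerProductSpace ℂ H) (_ : CompleteSpace H)
      (M : VonNeumannAlgebra H) (θ : M.toStarSubalgebra ≃⋆ₐ[ℂ] M.toStarSubalgebra),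
      IsIIOneFactor M ∧ IsLocallyInnerAut θ ∧ ¬ IsInnerAut θ := by
  have icc := Equiv.Perm.infinite_range_conj (X := ℕ)
  have hc : Equiv.swap 0 1 ≠ (1 : Equiv.Perm ℕ) := by
    rw [Ne, Equiv.swap_eq_one_iff]
    exact zero_ne_one
  -- The group already contains an infinite twisted class, that of `1`.
  have : Infinite (countablySupported ℝ (Equiv.Perm ℕ)) :=
    Set.infinite_univ_iff.1 ((infinite_range_conjConst icc hc 1).mono (Set.subset_univ _))
  exact ⟨EllTwo (countablySupported ℝ (Equiv.Perm ℕ)), inferInstance, inferInstance,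
    inferInstance, groupVN _, groupVNAut (conjConst (Equiv.swap 0 1)),
    isIIOneFactor_groupVN (infinite_range_conj_countablySupported icc),
    isLocallyInnerAut_groupVNAut _ (exists_conj_eq_conjConst _),
    not_isInnerAut_groupVNAut _ (infinite_range_conjConst icc hc)⟩
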